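/- Let $S$ be a monoid. A (left) $S$-act is a set $A$ with an action of $S$ satisfying $1a=a$ and $s(ta)=(st)a$; embeddings of acts are injective $S$-homomorphisms, and $N\leq M$ means that $N$ is a subact of $M$. $S$ is weakly left noetherian if for every left ideal $I$ of $S$ there is a finite set $X$ with $I=SX=\{sx : s\in S, x\in X\}$. Consider the class $(S\text{-acts},\leq)$ of all $S$-acts with embeddings, an abstract elementary class. Its Löwenheim–Skolem number $\operatorname{LS}$ is the least cardinal $\kappa\geq \operatorname{card}(S)+\aleph_0$ such that every subset $X$ of an act $A$ is contained in a subact of $A$ of cardinality at most $|X|+\kappa$. An act $M$ is universal over $N$ if $N\leq M$, $\|M\|=\|N\|$, and for every act $N^*$ with $N\leq N^*$ and $\|N^*\|=\|N\|$ there is an embedding $f:N^*\to M$ fixing $N$ pointwise. For an infinite cardinal $\lambda$ and a limit ordinal $\alpha<\lambda^+$, an act $M$ is a $(\lambda,\alpha)$-limit model if $M=\bigcup_{i<\alpha}M_i$ for an increasing continuous chain $(M_i)_{i<\alpha}$ of acts of cardinality $\lambda$ (continuous: $M_i=\bigcup_{j<i}M_j$ for every limit ordinal $i<\alpha$) such that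 $M_{i+1}$ is universal over $M_i$ for every $i<\alpha$; $M$ is a $\lambda$-limit model if it is a $(\lambda,\alpha)$-limit model for some limit ordinal $\alpha<\lambda^+$. The class $(S\text{-acts},\leq)$ is superstable if there is a cardinal $\mu\geq\operatorname{LS}$ such that for every cardinal $\lambda\geq\mu$ there is a $\lambda$-limit model and any two $\lambda$-limit models are isomorphic. Theorem. $S$ is weakly left noetherian if and only if $(S\text{-acts},\leq)$ is superstable. -/

import Mathlib

open Cardinal

universe u

namespace SAct

/-! Left `S`-acts are types with a `MulAction S`, homomorphisms are `→[S]`, embeddings are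
injective homomorphisms, subacts are `SubMulAction S A`, and left ideals of `S` are the subacts
of `S` acting on itself by left multiplication. -/

/-- `S` is weakly left noetherian: every left ideal is finitely generated. -/
def WeaklyLeftNoetherian (S : Type u) [Monoid S] : Prop :=
  ∀ I : SubMulAction S S, I.FG

/-- The Löwenheim-Skolem-Tarski number of the class of `S`-acts with embeddings: the least
cardinal `κ ≥ |L| + ℵ₀`, with `L = {s · : s ∈ S}` the language of acts, such that every subset `X`
of an act is contained in a subact of cardinality at most `|X| + κ`. -/
noncomputable def LS (S : Type u) [Monoid S] : Cardinal.{u} :=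
  sInf {κ : Cardinal.{u} | #S + ℵ₀ ≤ κ ∧
    ∀ (A : Type u) [MulAction S A] (X : Set A),
      ∃ B : SubMulAction S A, X ⊆ (B : Set A) ∧ #B ≤ #X + κ}

/-- For subacts `N`, `M` of an act, `M` is universal over `N`: `N ≤ M`, they have the same
cardinality, and every extension `N'` of `N` (along an embedding `j`) of this cardinality embeds
into `M` over `N`. -/
def IsUniversalOver {S : Type u} [Monoid S] {A : Type u} [MulAction S A]
    (M N : SubMulAction S A) : Prop :=
  N ≤ M ∧ #M = #N ∧
    ∀ (N' : Type u) [MulAction S N'], #N' = #N →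
      ∀ j : N →[S] N', Function.Injective j →
        ∃ f : N' →[S] M, Function.Injective f ∧ ∀ x : N, (f (j x) : A) = (x : A)

/-- The act `M` is a `(lam, α)`-limit model over its subact `N`. The values `C i` for `i ≥ α`
are irrelevant. -/
def IsLimitModelOver {S : Type u} [Monoid S] (lam : Cardinal.{u}) (α : Ordinal.{u})
    (M : Type u) [MulAction S M] (N : SubMulAction S M) : Prop :=
  ℵ₀ ≤ lam ∧ Order.IsSuccLimit α ∧ α < (Order.succ lam).ord ∧
    ∃ C : Ordinal.{u} → SubMulAction S M,
      (∀ i < α, #(C i) = lam) ∧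
      (∀ i j, i ≤ j → j < α → C i ≤ C j) ∧
      (∀ i < α, Order.IsSuccLimit i → (C i : Set M) = ⋃ j < i, (C j : Set M)) ∧
      C 0 = N ∧
      (⋃ i < α, (C i : Set M)) = Set.univ ∧
      (∀ i < α, IsUniversalOver (C (Order.succ i)) (C i))

/-- `M` is a `(lam, α)`-limit model: it is one over some act of cardinality `lam`. -/
def IsLimitModel (S : Type u) [Monoid S] (lam : Cardinal.{u}) (α : Ordinal.{u})
    (M : Type u) [MulAction S M] : Prop :=
  ∃ N : SubMulAction S M, #N = lam ∧ IsLimitModelOver lam α M N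

/-- `M` is a `lam`-limit model: it is a `(lam, α)`-limit model for some limit ordinal
`α < lam⁺`. -/
def IsCardLimitModel (S : Type u) [Monoid S] (lam : Cardinal.{u})
    (M : Type u) [MulAction S M] : Prop :=
  ∃ α : Ordinal.{u}, IsLimitModel S lam α M

/-- The class of `S`-acts has a unique `lam`-limit model: there is one, and any two of them, of
whatever lengths, are isomorphic. -/
def HasUniqueLimitModel (S : Type u) [Monoid S] (lam : Cardinal.{u}) : Prop :=
  (∃ (M : Type u) (_ : MulAction S M), IsCardLimitModel S lam M) ∧
    ∀ (M N : Type u) [MulAction S M] [MulAction S N],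
      IsCardLimitModel S lam M → IsCardLimitModel S lam N →
        ∃ f : M →[S] N, Function.Bijective f

/-- The class of `S`-acts with embeddings is superstable. -/
def Superstable (S : Type u) [Monoid S] : Prop :=
  ∃ μ : Cardinal.{u}, LS S ≤ μ ∧ ∀ lam : Cardinal.{u}, μ ≤ lam → HasUniqueLimitModel S lam

end SAct

/-!
A one-generator extension `A ∪ S m` of an act `A` is determined by the left ideal
`I = {s | s m ∈ A}`, the homomorphism `I → A`, `s ↦ s m`, and the pairs `(s, t)` with `s m = t m`.
Everything depends on whether the homomorphisms `I → A` are controlled by finitely many values.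

Suppose that `S` is weakly left noetherian. A homomorphism from a left ideal to the union of a
chain of acts then has its image in a member of the chain. If each member is universal over the
previous one, the pushout of a member with `lam` many copies of a cyclic act embeds into the next
member (`ExtendsInto.realizesFreely`). Hence, whatever the length of the chain, one-generator
extensions of subacts are realized in the union, with new elements that avoid any given set of fewer
than `lam` elements (`rich_of_chain`). Two acts of cardinality `lam` with this property are
isomorphic by a back-and-forth construction of length `lam` (`Rich.exists_iso`), so limit models
are unique if `#S < lam`.

For existence, an act of cardinality `lam ≥ 2 ^ (#S + ℵ₀)` has only `lam` many one-generator
extensions up to isomorphism, because a homomorphism `I → A` is given by finitely many values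
(`RealizesFreely.exists_small`). Adding `lam` copies of all of them, `ω` times, gives an act that is
rich over `A`, and the forth direction of the construction above shows that it is universal over
`A` (`Rich.extendsInto`). These steps take place inside a cofree act, which is large enough to
contain all acts of cardinality `lam`.

If `S` is not weakly left noetherian, there is a sequence `f` in `S` no term of which is in the left
ideal generated by the earlier ones. Let `J` be the left ideal generated by `f`. Copies of `J`
indexed by sequences `ℕ → lam`, identified along common initial segments, form an act of cardinality
`lam` with `lam ^ ℵ₀` homomorphisms from `J` (`Tree.branch`). In a chain `C₀ ≤ C₁ ≤ C₂` of acts of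
cardinality `lam`, each universal over the previous one, this act embeds into `C₁`, and the
extensions of `C₁` by elements that realize these homomorphisms embed into `C₂`, so that
`lam ^ ℵ₀ ≤ lam` (`IsIrredundant.power_aleph0_le`). By König's theorem this fails for arbitrarily
large `lam`, and for these there are no limit models at all.
-/

namespace SAct

/-! ### Transfinite constructions by small extensions -/

/-- A construction in `lam` steps. Let `good` be a property of sets closed under unions of chains.
If each of at most `lam` tasks can be accomplished by a good extension with at most `κ < lam` new
elements, as long as fewer than `lam` elements have been added to `P₀`, then some good extension of
`P₀` accomplishes all tasks. -/
theorem exists_subset_of_small_extensions {T K : Type u} {lam κ : Cardinal.{u}} (hlam : ℵ₀ ≤ lam)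
    (hκ : κ < lam) (hK : #K ≤ lam) (good : Set T → Prop) (P₀ : Set T) (hP₀ : good P₀)
    (hchain : ∀ c : Set (Set T), c.Nonempty → IsChain (· ⊆ ·) c → (∀ P ∈ c, good P) →
      good (⋃₀ c))
    (task : K → Set T → Prop) (hmono : ∀ k P Q, P ⊆ Q → task k P → task k Q)
    (hstep : ∀ P, P₀ ⊆ P → good P → #(P \ P₀ : Set T) < lam → ∀ k, ∃ Q, P ⊆ Q ∧ good Q ∧
      #(Q \ P : Set T) ≤ κ ∧ task k Q) :
    ∃ P, P₀ ⊆ P ∧ good P ∧ ∀ k, task k P := by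
  classical
  let L := lam.ord.ToType
  have hL : #L = lam := mk_ord_toType lam
  obtain ⟨e⟩ : Nonempty (K ↪ L) := by
    rw [← hL] at hK
    exact hK
  let admissible : L → Set T → Set T → Prop := fun i P Q =>
    P ⊆ Q ∧ good Q ∧ #(Q \ P : Set T) ≤ κ ∧ ∀ k, e k = i → task k Q
  -- Where there is no admissible extension, `next` is the identity, so that monotonicity and the
  -- bound on the number of new elements hold unconditionally.
  let next : L → Set T → Set T := fun i P =>
    if h : ∃ Q, admissible i P Q then h.choose else P
  have next_spec : ∀ i P, (∃ Q, admissible i P Q) → admissible i P (next i P) := by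
    intro i P h
    simp only [next, dif_pos h]
    exact h.choose_spec
  have le_next : ∀ i P, P ⊆ next i P := by
    intro i P
    by_cases h : ∃ Q, admissible i P Q
    · exact (next_spec i P h).1
    · simp [next, dif_neg h]
  have card_next : ∀ i P, #(next i P \ P : Set T) ≤ κ := by
    intro i P
    by_cases h : ∃ Q, admissible i P Q
    · exact (next_spec i P h).2.2.1
    · simp [next, dif_neg h]
  let ind : ∀ i : L, (∀ j, j < i → Set T) → Set T := fun i ih =>
    next i (P₀ ∪ ⋃ j : Set.Iio i, ih j.1 j.2)
  let R : L → Set T := WellFoundedLT.fix ind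
  let prev : L → Set T := fun i => P₀ ∪ ⋃ j : Set.Iio i, R j.1
  have hR : ∀ i, R i = next i (prev i) := fun i => WellFoundedLT.fix_eq ind i
  have hprev_R : ∀ i, prev i ⊆ R i := fun i => (hR i).symm ▸ le_next i (prev i)
  have hR_prev : ∀ i j, i < j → R i ⊆ prev j := fun i j hij =>
    (Set.subset_iUnion (fun l : Set.Iio j => R l.1) ⟨i, hij⟩).trans Set.subset_union_right
  have hR_mono : ∀ i j, i ≤ j → R i ⊆ R j := by
    intro i j hij
    rcases hij.eq_or_lt with rfl | h
    · exact subset_rfl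
    · exact (hR_prev i j h).trans (hprev_R j)
  have hP₀R : ∀ i, P₀ ⊆ R i := fun i => Set.subset_union_left.trans (hprev_R i)
  -- Only the increments `R j \ prev j`, of size at most `κ`, add elements outside `P₀`.
  have hcover : ∀ i, R i ⊆ P₀ ∪ ⋃ j : Set.Iic i, (R j.1 \ prev j.1) := by
    intro i
    induction i using WellFoundedLT.induction with
    | ind i ih =>
      intro x hx
      by_cases hp : x ∈ prev i
      · rcases hp with hp | hp
        · exact Or.inl hp
        · obtain ⟨⟨j, hj⟩, hxj⟩ := Set.mem_iUnion.1 hp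
          rcases ih j hj hxj with h | h
          · exact Or.inl h
          · obtain ⟨⟨l, hl⟩, hxl⟩ := Set.mem_iUnion.1 h
            exact Or.inr (Set.mem_iUnion.2
              ⟨⟨l, (Set.mem_Iic.1 hl).trans (Set.mem_Iio.1 hj).le⟩, hxl⟩)
      · exact Or.inr (Set.mem_iUnion.2 ⟨⟨i, Set.mem_Iic.2 le_rfl⟩, hx, hp⟩)
  have hsmall : ∀ i, #(prev i \ P₀ : Set T) < lam := by
    intro i
    have hsub : (prev i \ P₀ : Set T) ⊆ ⋃ j : Set.Iio i, (R j.1 \ prev j.1) := by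
      rintro x ⟨hx | hx, hx0⟩
      · exact absurd hx hx0
      · obtain ⟨⟨j, hj⟩, hxj⟩ := Set.mem_iUnion.1 hx
        rcases hcover j hxj with h | h
        · exact absurd h hx0
        · obtain ⟨⟨l, hl⟩, hxl⟩ := Set.mem_iUnion.1 h
          exact Set.mem_iUnion.2 ⟨⟨l, (Set.mem_Iic.1 hl).trans_lt (Set.mem_Iio.1 hj)⟩, hxl⟩
    calc #(prev i \ P₀ : Set T) ≤ #(⋃ j : Set.Iio i, (R j.1 \ prev j.1) : Set T) :=
          mk_le_mk_of_subset hsub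
      _ ≤ #(Set.Iio i) * ⨆ j : Set.Iio i, #(R j.1 \ prev j.1 : Set T) := mk_iUnion_le _
      _ ≤ #(Set.Iio i) * κ := by
          gcongr
          refine ciSup_le' fun j => ?_
          rw [hR]
          exact card_next _ _
      _ < lam := by
          refine mul_lt_of_lt hlam ?_ hκ
          have := mk_Iio_lt i (by rw [hL]; simp [L])
          rwa [hL] at this
  have hgood : ∀ i, good (prev i) ∧ admissible i (prev i) (R i) := by
    intro i
    induction i using WellFoundedLT.induction with
    | ind i ih =>
      have hp : good (prev i) := by
        have heq : prev i = ⋃₀ (insert P₀ (Set.range fun j : Set.Iio i => R j.1)) := by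
          simp [prev, Set.sUnion_range]
        rw [heq]
        refine hchain _ ⟨P₀, Or.inl rfl⟩ ?_ ?_
        · refine IsChain.insert ?_ ?_
          · rintro _ ⟨a, rfl⟩ _ ⟨b, rfl⟩ -
            rcases le_total a.1 b.1 with h | h
            · exact Or.inl (hR_mono _ _ h)
            · exact Or.inr (hR_mono _ _ h)
          · rintro _ ⟨a, rfl⟩ -
            exact Or.inl (hP₀R _)
        · rintro _ (rfl | ⟨j, rfl⟩)
          · exact hP₀
          · exact (ih j.1 j.2).2.2.1
      refine ⟨hp, ?_⟩
      rw [hR]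
      apply next_spec
      have h0 : P₀ ⊆ prev i := Set.subset_union_left
      by_cases hk : ∃ k, e k = i
      · obtain ⟨k, rfl⟩ := hk
        obtain ⟨Q, h1, h2, h3, h4⟩ := hstep _ h0 hp (hsmall _) k
        refine ⟨Q, h1, h2, h3, fun k' hk' => ?_⟩
        rwa [e.injective hk']
      · exact ⟨prev i, subset_rfl, hp, by simp, fun k h => absurd ⟨k, h⟩ hk⟩
  refine ⟨⋃₀ (insert P₀ (Set.range R)), Set.subset_sUnion_of_mem (Or.inl rfl), ?_, ?_⟩
  · refine hchain _ ⟨P₀, Or.inl rfl⟩ ?_ ?_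
    · refine IsChain.insert ?_ ?_
      · rintro _ ⟨a, rfl⟩ _ ⟨b, rfl⟩ -
        rcases le_total a b with h | h
        · exact Or.inl (hR_mono _ _ h)
        · exact Or.inr (hR_mono _ _ h)
      · rintro _ ⟨a, rfl⟩ -
        exact Or.inl (hP₀R _)
    · rintro _ (rfl | ⟨j, rfl⟩)
      · exact hP₀
      · exact (hgood j).2.2.1
  · intro k
    exact hmono k _ _ (Set.subset_sUnion_of_mem (Or.inr ⟨e k, rfl⟩)) ((hgood (e k)).2.2.2.2 k rfl)

variable {S : Type u} [Monoid S]

/-! ### Free amalgams -/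

/-- The pushout of `A` and `K`-many copies of an act `M` along a homomorphism `h` from a subact `D`
of `M` to `A`. Its elements are those of `A` and one copy of `M \ D` for each `k : K`. -/
inductive FreeAmalgam {A M : Type u} [MulAction S A] [MulAction S M] {D : SubMulAction S M}
    (h : D →[S] A) (K : Type u) : Type u
  | ofBase (a : A) : FreeAmalgam h K
  | ofCopy (k : K) (x : M) (hx : x ∉ D) : FreeAmalgam h K

namespace FreeAmalgam

variable {A M : Type u} [MulAction S A] [MulAction S M] {D : SubMulAction S M}
  (h : D →[S] A) {K : Type u}

open Classical in
/-- The image of `x : M` under the `k`-th homomorphism `M → FreeAmalgam h K`. -/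
noncomputable def copy (k : K) (x : M) : FreeAmalgam h K :=
  if hx : x ∈ D then ofBase (h ⟨x, hx⟩) else ofCopy k x hx

theorem copy_of_mem (k : K) {x : M} (hx : x ∈ D) : copy h k x = ofBase (h ⟨x, hx⟩) :=
  dif_pos hx

theorem copy_of_notMem (k : K) {x : M} (hx : x ∉ D) : copy h k x = ofCopy k x hx :=
  dif_neg hx

noncomputable instance : SMul S (FreeAmalgam h K) where
  smul s y := match y with
    | ofBase a => ofBase (s • a)
    | ofCopy k x _ => copy h k (s • x)

theorem smul_ofBase (s : S) (a : A) : s • (ofBase a : FreeAmalgam h K) = ofBase (s • a) := rfl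

theorem smul_copy (s : S) (k : K) (x : M) : s • copy h k x = copy h k (s • x) := by
  by_cases hx : x ∈ D
  · rw [copy_of_mem h k hx, copy_of_mem h k (D.smul_mem s hx), smul_ofBase, ← map_smul]
    rfl
  · rw [copy_of_notMem h k hx]
    rfl

theorem eq_ofBase_or_eq_copy (y : FreeAmalgam h K) :
    (∃ a, y = ofBase a) ∨ ∃ k x, y = copy h k x := by
  rcases y with a | ⟨k, x, hx⟩
  · exact Or.inl ⟨a, rfl⟩
  · exact Or.inr ⟨k, x, (copy_of_notMem h k hx).symm⟩

noncomputable instance : MulAction S (FreeAmalgam h K) where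
  one_smul y := by
    rcases eq_ofBase_or_eq_copy h y with ⟨a, rfl⟩ | ⟨k, x, rfl⟩
    · rw [smul_ofBase, one_smul]
    · rw [smul_copy, one_smul]
  mul_smul s t y := by
    rcases eq_ofBase_or_eq_copy h y with ⟨a, rfl⟩ | ⟨k, x, rfl⟩
    · simp only [smul_ofBase, mul_smul]
    · simp only [smul_copy, mul_smul]

variable (K) in
/-- The inclusion of `A` into the pushout. -/
def base : A →[S] FreeAmalgam h K where
  toFun := ofBase
  map_smul' _ _ := rfl

theorem base_injective : Function.Injective (base h K) := fun _ _ e => ofBase.inj e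

theorem copy_ne_base (k : K) {x : M} (hx : x ∉ D) (a : A) : copy h k x ≠ base h K a := by
  rw [copy_of_notMem h k hx]
  exact nofun

theorem copy_eq_copy_iff (k l : K) {x y : M} (hx : x ∉ D) (hy : y ∉ D) :
    copy h k x = copy h l y ↔ k = l ∧ x = y := by
  rw [copy_of_notMem h k hx, copy_of_notMem h l hy, ofCopy.injEq]

theorem mk_eq (hA : ℵ₀ ≤ #A) (hK : #K ≤ #A) (hM : #M ≤ #A) : #(FreeAmalgam h K) = #A := by
  refine le_antisymm ?_ (mk_le_of_injective (base_injective h (K := K)))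
  let toSum : FreeAmalgam h K → A ⊕ (K × M) := fun y => match y with
    | ofBase a => Sum.inl a
    | ofCopy k x _ => Sum.inr (k, x)
  have htoSum : Function.Injective toSum := by
    rintro (a | ⟨k, x, hx⟩) (b | ⟨l, y, hy⟩) e <;> simp_all [toSum]
  refine (mk_le_of_injective htoSum).trans ?_
  simp only [mk_sum, mk_prod, lift_id]
  exact add_le_of_le hA le_rfl (mul_le_of_le hA hK hM)

end FreeAmalgam

/-! ### Realizing one-generator extensions -/

variable {W : Type u} [MulAction S W]

/-- Every extension of `A` of the same cardinality embeds into `B` over `A`. -/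
def ExtendsInto (A B : SubMulAction S W) : Prop :=
  ∀ (N' : Type u) [MulAction S N'], #N' = #A → ∀ j : A →[S] N', Function.Injective j →
    ∃ f : N' →[S] B, Function.Injective f ∧ ∀ x : A, (f (j x) : W) = (x : W)

/-- The elements `c k` of `W` generate copies of the act `S • m` which are amalgamated with `A`
along `h` and are otherwise disjoint from `A` and from each other. -/
structure IsFreeFamily (A : SubMulAction S W) {K M : Type u} [MulAction S M] (m : M)
    {D : SubMulAction S M} (h : D →[S] A) (c : K → W) : Prop where
  smul_of_mem : ∀ k (s : S) (hs : s • m ∈ D), s • c k = h ⟨s • m, hs⟩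
  smul_notMem : ∀ k (s : S), s • m ∉ D → s • c k ∉ A
  smul_eq_iff : ∀ k l (s t : S), s • m ∉ D → t • m ∉ D →
    (s • c k = t • c l ↔ k = l ∧ s • m = t • m)

/-- Every one-generator extension of `A` along a homomorphism `D → A`, with `D` a subact of a
cyclic act, is realized in `B` by a free family indexed by `K`. The ambient act `M` of the
generator `m` need not be cyclic, but only the subact `S • m` matters. -/
def RealizesFreely (A B : SubMulAction S W) (K : Type u) : Prop :=
  ∀ (M : Type u) [MulAction S M], #M ≤ #A → ∀ (m : M) (D : SubMulAction S M) (h : D →[S] A),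
    ∃ c : K → W, (∀ k, c k ∈ B) ∧ IsFreeFamily A m h c

theorem ExtendsInto.realizesFreely {A B : SubMulAction S W} {K : Type u} (hA : ℵ₀ ≤ #A)
    (hK : #K ≤ #A) (hAB : ExtendsInto A B) : RealizesFreely A B K := by
  intro M _ hM m D h
  obtain ⟨f, hf, hfA⟩ := hAB (FreeAmalgam h K) (FreeAmalgam.mk_eq h hA hK hM)
    (FreeAmalgam.base h K) (FreeAmalgam.base_injective h)
  have hs : ∀ (s : S) (k : K),
      s • (f (FreeAmalgam.copy h k m) : W) = f (FreeAmalgam.copy h k (s • m)) := by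
    intro s k
    rw [← FreeAmalgam.smul_copy, map_smul]
    rfl
  refine ⟨fun k => f (FreeAmalgam.copy h k m), fun k => (f _).2, ?_, ?_, ?_⟩
  · intro k s hsm
    rw [hs, FreeAmalgam.copy_of_mem h k hsm]
    exact hfA _
  · intro k s hsm hmem
    rw [hs] at hmem
    refine FreeAmalgam.copy_ne_base h k hsm ⟨_, hmem⟩ (hf (Subtype.ext ?_))
    rw [hfA]
  · intro k l s t hsm htm
    rw [hs, hs, ← FreeAmalgam.copy_eq_copy_iff h k l hsm htm]
    exact Subtype.coe_injective.eq_iff.trans hf.eq_iff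

/-! ### Cofree acts -/

/-- The cofree act on `X`: functions `S → X`, with `S` acting by right translation of the
argument. -/
def Cofree (S X : Type u) : Type u := S → X

namespace Cofree

variable {X : Type u}

instance : MulAction S (Cofree S X) where
  smul s f := fun t => f (t * s)
  one_smul f := funext fun t => congrArg f (mul_one t)
  mul_smul s s' f := funext fun t => congrArg f (mul_assoc t s s').symm

theorem smul_apply (s t : S) (f : Cofree S X) : (s • f) t = f (t * s) := rfl

/-- Homomorphisms to `Cofree S X` correspond to arbitrary functions to `X`, by evaluation at `1`.
An embedding of an extension is obtained by giving the new elements fresh values in `X`. -/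
theorem extendsInto_top (A : SubMulAction S (Cofree S X)) (hA : ℵ₀ ≤ #A) (hX : #A < #X) :
    ExtendsInto A ⊤ := by
  classical
  intro N' _ hN' j hj
  have : Infinite X := infinite_iff.2 (hA.trans hX.le)
  let vals : Set X := Set.range fun a : A => (a : Cofree S X) 1
  have hvals : #vals < #X := mk_range_le.trans_lt hX
  obtain ⟨g⟩ : Nonempty (N' ↪ (valsᶜ : Set X)) := by
    change #N' ≤ #(valsᶜ : Set X)
    rw [mk_compl_of_infinite vals hvals, hN']
    exact hX.le
  let φ : N' → X := fun y =>
    if h : ∃ a, j a = y then (h.choose : Cofree S X) 1 else g y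
  have hφj : ∀ a, φ (j a) = (a : Cofree S X) 1 := by
    intro a
    have h : ∃ b, j b = j a := ⟨a, rfl⟩
    simp only [φ, dif_pos h]
    rw [hj h.choose_spec]
  have hφg : ∀ y, (¬ ∃ a, j a = y) → φ y = g y := fun y h => dif_neg h
  let F : N' → Cofree S X := fun y t => φ (t • y)
  have hF : ∀ a, F (j a) = a := by
    intro a
    funext t
    change φ (t • j a) = _
    rw [← map_smul, hφj, SubMulAction.val_smul, smul_apply, one_mul]
  refine ⟨⟨fun y => ⟨F y, trivial⟩, fun s y => Subtype.ext (funext fun t => ?_)⟩, ?_, hF⟩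
  · exact congrArg φ (smul_smul t s y)
  · intro y z hyz
    have hFyz : F y = F z := congrArg Subtype.val hyz
    have hφyz : φ y = φ z := by
      have := congrFun hFyz 1
      simpa only [F, one_smul] using this
    by_cases hy : ∃ a, j a = y <;> by_cases hz : ∃ a, j a = z
    · obtain ⟨a, rfl⟩ := hy
      obtain ⟨b, rfl⟩ := hz
      rw [hF, hF] at hFyz
      rw [Subtype.ext hFyz]
    · obtain ⟨a, rfl⟩ := hy
      rw [hφj, hφg z hz] at hφyz
      exact absurd ⟨a, hφyz⟩ (g z).2
    · obtain ⟨b, rfl⟩ := hz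
      rw [hφj, hφg y hy] at hφyz
      exact absurd ⟨b, hφyz.symm⟩ (g y).2
    · rw [hφg y hy, hφg z hz] at hφyz
      exact g.injective (Subtype.ext hφyz)

theorem exists_subMulAction_mk_eq (lam : Cardinal.{u}) (hX : lam ≤ #X) :
    ∃ A : SubMulAction S (Cofree S X), #A = lam := by
  obtain ⟨Y, hY⟩ := le_mk_iff_exists_set.1 hX
  refine ⟨⟨Set.range fun y : Y => (fun _ : S => (y : X)), ?_⟩, ?_⟩
  · rintro s _ ⟨y, rfl⟩
    exact ⟨y, rfl⟩
  · rw [← hY]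
    exact mk_range_eq _ fun y z h => Subtype.ext (congrFun h 1)

end Cofree

/-! ### Stability over a weakly left noetherian monoid -/

theorem mem_closure_iff {A : Type u} [MulAction S A] {X : Set A} {x : A} :
    x ∈ SubMulAction.closure S X ↔ ∃ g ∈ X, ∃ s : S, s • g = x := by
  constructor
  · intro h
    let p : SubMulAction S A :=
      { carrier := {x | ∃ g ∈ X, ∃ s : S, s • g = x}
        smul_mem' := by
          rintro t _ ⟨g, hg, s, rfl⟩
          exact ⟨g, hg, t * s, mul_smul t s g⟩ }
    exact SubMulAction.mem_closure.1 h p fun g hg => ⟨g, hg, 1, one_smul S g⟩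
  · rintro ⟨g, hg, s, rfl⟩
    exact SubMulAction.smul_mem _ s (SubMulAction.subset_closure hg)

theorem WeaklyLeftNoetherian.exists_finset (hS : WeaklyLeftNoetherian S) (I : SubMulAction S S) :
    ∃ G : Finset S, (∀ g ∈ G, g ∈ I) ∧ ∀ s ∈ I, ∃ g ∈ G, ∃ t, t * g = s := by
  obtain ⟨G, hG⟩ := SubMulAction.fg_iff.1 (hS I)
  refine ⟨G, fun g hg => hG ▸ SubMulAction.subset_closure hg, fun s hs => ?_⟩
  rw [hG] at hs
  exact mem_closure_iff.1 hs

/-- The left ideal `{s | s • m ∈ D}`. -/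
def transporter {M : Type u} [MulAction S M] (D : SubMulAction S M) (m : M) :
    SubMulAction S S where
  carrier := {s | s • m ∈ D}
  smul_mem' t s hs := by
    change (t * s) • m ∈ D
    rw [mul_smul]
    exact D.smul_mem t hs

/-- If left ideals are finitely generated, the isomorphism type of a one-generator extension of `A`
is determined by a set of pairs in `S` (its relations), a left ideal (the part of the orbit inside
`A`), and a finite subset of `S × A` (the values on generators of that ideal). There are at most
`#A` of these, so free families for all of them can be collected in a subact of cardinality
`#A`. -/
theorem RealizesFreely.exists_small (hS : WeaklyLeftNoetherian S) {A : SubMulAction S W}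
    {K : Type u} (hA : 2 ^ (#S + ℵ₀) ≤ #A) (hK : #K ≤ #A) (h : RealizesFreely A ⊤ K) :
    ∃ B, A ≤ B ∧ #B = #A ∧ RealizesFreely A B K := by
  classical
  have hSA : #S + ℵ₀ ≤ #A := (cantor _).le.trans hA
  have hA₀ : ℵ₀ ≤ #A := (self_le_add_left _ _).trans hSA
  have hS' : #S ≤ #A := (self_le_add_right _ _).trans hSA
  have : Infinite A := infinite_iff.2 hA₀
  have : Infinite (S × A) := inferInstance
  let Q := Set (S × S) × Set S × Finset (S × A)
  let real : Q → (K → W) → Prop := fun q c =>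
    (∀ k, ∀ p ∈ q.2.2, p.1 • c k = p.2) ∧ (∀ k (s : S), s ∉ q.2.1 → s • c k ∉ A) ∧
      ∀ k l (s t : S), s ∉ q.2.1 → t ∉ q.2.1 → (s • c k = t • c l ↔ k = l ∧ (s, t) ∈ q.1)
  choose c hc using fun q : {q // ∃ c, real q c} => q.2
  have hQ : #Q ≤ #A := by
    simp only [Q, mk_prod, lift_id, mk_set, mk_finset_of_infinite]
    have hκ : ℵ₀ ≤ #S + ℵ₀ := self_le_add_left _ _
    have h1 : (2 : Cardinal.{u}) ^ (#S * #S) ≤ #A :=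
      (power_le_power_left two_ne_zero
        (mul_le_of_le hκ (self_le_add_right _ _) (self_le_add_right _ _))).trans hA
    have h2 : (2 : Cardinal.{u}) ^ #S ≤ #A :=
      (power_le_power_left two_ne_zero (self_le_add_right _ _)).trans hA
    exact mul_le_of_le hA₀ h1 (mul_le_of_le hA₀ h2 (mul_le_of_le hA₀ hS' le_rfl))
  let new : {q // ∃ c, real q c} × K × S → W := fun p => p.2.2 • c p.1 p.2.1
  let B : SubMulAction S W :=
    { carrier := A ∪ Set.range new
      smul_mem' := by
        rintro s x (hx | ⟨⟨q, k, t⟩, rfl⟩)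
        · exact Or.inl (A.smul_mem s hx)
        · exact Or.inr ⟨⟨q, k, s * t⟩, mul_smul s t _⟩ }
  have hAB : A ≤ B := fun x hx => Or.inl hx
  refine ⟨B, hAB, le_antisymm ?_ (mk_le_mk_of_subset hAB), ?_⟩
  · refine (mk_union_le _ _).trans (add_le_of_le hA₀ le_rfl (mk_range_le.trans ?_))
    simp only [mk_prod, lift_id]
    exact mul_le_of_le hA₀ ((mk_subtype_le _).trans hQ) (mul_le_of_le hA₀ hK hS')
  · intro M _ hM m D φ
    obtain ⟨c', -, hc'⟩ := h M hM m D φ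
    obtain ⟨G, hGI, hG⟩ := hS.exists_finset (transporter D m)
    let q : Q := ({p | p.1 • m = p.2 • m}, {s | s • m ∈ D},
      G.attach.image fun g => (g.1, φ ⟨g.1 • m, hGI g.1 g.2⟩))
    have hq : real q c' := by
      refine ⟨?_, hc'.smul_notMem, hc'.smul_eq_iff⟩
      intro k p hp
      obtain ⟨g, -, rfl⟩ := Finset.mem_image.1 hp
      exact hc'.smul_of_mem k g.1 _
    obtain ⟨h1, h2, h3⟩ := hc ⟨q, c', hq⟩
    refine ⟨c ⟨q, c', hq⟩, fun k => Or.inr ⟨(⟨q, c', hq⟩, k, 1), one_smul S _⟩, ?_, h2, h3⟩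
    intro k s hs
    obtain ⟨g, hg, t, rfl⟩ := hG s hs
    have := h1 k _ (Finset.mem_image.2 ⟨⟨g, hg⟩, Finset.mem_attach _ _, rfl⟩)
    rw [mul_smul, this, ← SubMulAction.val_smul, ← map_smul]
    congr 2
    exact Subtype.ext (mul_smul t g m).symm

/-! ### Saturation over few new elements -/

/-- `U` realizes every one-generator extension along an embedding `h : D → U`, where `D` is a
subact of a (cyclic) act of cardinality at most `lam`, in such a way that the new elements avoid
`base` and any given set of fewer than `lam` elements. -/
def Rich (lam : Cardinal.{u}) (base : Set W) (U : SubMulAction S W) : Prop :=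
  ∀ (M : Type u) [MulAction S M], #M ≤ lam → ∀ (m : M) (D : SubMulAction S M) (h : D →[S] U),
    Function.Injective h → ∀ X : Set W, #X < lam →
      ∃ n ∈ U, (∀ (s : S) (hs : s • m ∈ D), s • n = h ⟨s • m, hs⟩) ∧
        (∀ s : S, s • m ∉ D → s • n ∉ base ∪ X) ∧
        ∀ s t : S, s • m ∉ D → t • m ∉ D → (s • n = t • n ↔ s • m = t • m)

/-- In the union of a chain in which one-generator extensions of each member are realized freely by
a later member, all one-generator extensions along embeddings `D → U` are realized: as the ideal
`{s | s • m ∈ D}` is finitely generated, the relevant part of `D` is mapped into a member of the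
chain. -/
theorem rich_of_chain (hS : WeaklyLeftNoetherian S) {ι : Type*} [LinearOrder ι]
    {lam : Cardinal.{u}} {K : Type u} (hK : #K = lam) (C : ι → SubMulAction S W) (hC : Monotone C)
    (hcard : ∀ i, #(C i) = lam) (hfree : ∀ i, ∃ j, RealizesFreely (C i) (C j) K)
    (U : SubMulAction S W) (hU : (U : Set W) = ⋃ i, (C i : Set W)) (i₀ : ι) :
    Rich lam (C i₀ : Set W) U := by
  classical
  intro M _ hM m D h hh X hX
  have : Nonempty ι := ⟨i₀⟩
  obtain ⟨G, hGI, hG⟩ := hS.exists_finset (transporter D m)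
  have hGD : ∀ g : G, (g : S) • m ∈ D := fun g => hGI g.1 g.2
  have hmem : ∀ x : U, ∃ i, (x : W) ∈ C i := by
    rintro ⟨x, hx⟩
    have : x ∈ ⋃ i, (C i : Set W) := hU ▸ hx
    exact Set.mem_iUnion.1 this
  choose r hr using hmem
  obtain ⟨i, hi⟩ := Finset.exists_le
    (insert i₀ (G.attach.image fun g : G => r (h ⟨(g : S) • m, hGD g⟩)))
  have hi₀ : i₀ ≤ i := hi _ (Finset.mem_insert_self _ _)
  let D' : SubMulAction S M :=
    { carrier := {x | ∃ hx : x ∈ D, (h ⟨x, hx⟩ : W) ∈ C i}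
      smul_mem' := by
        rintro s x ⟨hx, hxi⟩
        refine ⟨D.smul_mem s hx, ?_⟩
        have : h ⟨s • x, D.smul_mem s hx⟩ = s • h ⟨x, hx⟩ := map_smul h s ⟨x, hx⟩
        rw [this]
        exact (C i).smul_mem s hxi }
  have hD' : ∀ s : S, s • m ∈ D' ↔ s • m ∈ D := by
    refine fun s => ⟨fun hs => hs.1, fun hs => ?_⟩
    obtain ⟨g, hg, t, rfl⟩ := hG s hs
    have hg' : g • m ∈ D' := by
      refine ⟨hGI g hg, hC (hi _ ?_) (hr _)⟩
      exact Finset.mem_insert_of_mem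
        (Finset.mem_image.2 ⟨⟨g, hg⟩, Finset.mem_attach _ _, rfl⟩)
    rw [mul_smul]
    exact D'.smul_mem t hg'
  let h' : D' →[S] C i :=
    { toFun := fun x => ⟨h ⟨x.1, x.2.1⟩, x.2.2⟩
      map_smul' := fun s x => Subtype.ext (congrArg (fun y : U => (y : W)) (map_smul h s ⟨x.1, x.2.1⟩)) }
  obtain ⟨j, hj⟩ := hfree i
  obtain ⟨c, hcj, hc⟩ := hj M (hM.trans (hcard i).ge) m D' h'
  -- Each point of `X` spoils at most one of the `lam` many disjoint copies.
  obtain ⟨k, hk⟩ : ∃ k, ∀ s : S, s • m ∉ D → s • c k ∉ X := by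
    by_contra! hcon
    choose s hsD hsX using hcon
    refine hX.not_ge (hK ▸ mk_le_of_injective (f := fun k => (⟨s k • c k, hsX k⟩ : X)) ?_)
    intro k l hkl
    exact ((hc.smul_eq_iff k l (s k) (s l) (mt (hD' _).1 (hsD k)) (mt (hD' _).1 (hsD l))).1
      (congrArg Subtype.val hkl)).1
  refine ⟨c k, ?_, fun s hs => hc.smul_of_mem k s ((hD' s).2 hs), fun s hs => ?_,
    fun s t hs ht => ?_⟩
  · have : c k ∈ ⋃ i, (C i : Set W) := Set.mem_iUnion.2 ⟨j, hcj k⟩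
    rwa [← hU] at this
  · rintro (hb | hb)
    · exact hc.smul_notMem k s (mt (hD' s).1 hs) (hC hi₀ hb)
    · exact hk s hs hb
  · rw [hc.smul_eq_iff k k s t (mt (hD' s).1 hs) (mt (hD' t).1 ht)]
    exact and_iff_right rfl

/-! ### Partial isomorphisms -/

/-- A set of pairs that is the graph of an isomorphism between a subact of `M` and one of `N`. -/
structure IsPartialIso (S : Type u) [Monoid S] {M N : Type u} [MulAction S M] [MulAction S N]
    (P : Set (M × N)) : Prop where
  smul_mem : ∀ (s : S), ∀ p ∈ P, s • p ∈ P
  fst_eq_iff : ∀ p ∈ P, ∀ q ∈ P, p.1 = q.1 ↔ p.2 = q.2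

namespace IsPartialIso

variable {M N : Type u} [MulAction S M] [MulAction S N]

theorem swap {P : Set (M × N)} (hP : IsPartialIso S P) : IsPartialIso S (Prod.swap ⁻¹' P) where
  smul_mem s p hp := hP.smul_mem s p.swap hp
  fst_eq_iff p hp q hq := (hP.fst_eq_iff p.swap hp q.swap hq).symm

theorem sUnion {c : Set (Set (M × N))} (hc : IsChain (· ⊆ ·) c)
    (h : ∀ P ∈ c, IsPartialIso S P) : IsPartialIso S (⋃₀ c) where
  smul_mem := by
    rintro s p ⟨P, hP, hp⟩
    exact ⟨P, hP, (h P hP).smul_mem s p hp⟩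
  fst_eq_iff := by
    rintro p ⟨P, hP, hp⟩ q ⟨Q, hQ, hq⟩
    rcases hc.total hP hQ with hPQ | hQP
    · exact (h Q hQ).fst_eq_iff p (hPQ hp) q hq
    · exact (h P hP).fst_eq_iff p hp q (hQP hq)

/-- A partial isomorphism with domain `M` is the graph of an embedding. -/
theorem exists_embedding {P : Set (M × N)} (hP : IsPartialIso S P) (h : ∀ m, ∃ n, (m, n) ∈ P) :
    ∃ f : M →[S] N, Function.Injective f ∧ ∀ m, (m, f m) ∈ P := by
  choose f hf using h
  refine ⟨⟨f, fun s m => ?_⟩, fun m m' e => ?_, hf⟩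
  · exact (hP.fst_eq_iff _ (hf (s • m)) _ (hP.smul_mem s _ (hf m))).1 rfl
  · exact (hP.fst_eq_iff _ (hf m) _ (hf m')).2 e

/-- A partial isomorphism whose range lies in a rich `U`, and has fewer than `lam` elements outside
`base`, can be extended to any `m : M`. -/
theorem exists_extension {lam : Cardinal.{u}} {base : Set N} {U : SubMulAction S N}
    (hU : Rich lam base U) (hM : #M ≤ lam) {P : Set (M × N)} (hP : IsPartialIso S P)
    (hPU : ∀ p ∈ P, p.2 ∈ U) {P₀ : Set (M × N)} (hP₀ : ∀ p ∈ P₀, p.2 ∈ base)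
    (hcard : #(P \ P₀ : Set (M × N)) < lam) (m : M) :
    ∃ Q, P ⊆ Q ∧ IsPartialIso S Q ∧ (∀ p ∈ Q, p.2 ∈ U) ∧ #(Q \ P : Set (M × N)) ≤ #S ∧
      ∃ n, (m, n) ∈ Q := by
  let D : SubMulAction S M :=
    { carrier := {x | ∃ y, (x, y) ∈ P}
      smul_mem' := by
        rintro s x ⟨y, hy⟩
        exact ⟨s • y, hP.smul_mem s _ hy⟩ }
  choose g hg using fun x : D => x.2
  let h : D →[S] U :=
    { toFun := fun x => ⟨g x, hPU _ (hg x)⟩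
      map_smul' := fun s x => Subtype.ext
        ((hP.fst_eq_iff _ (hg (s • x)) _ (hP.smul_mem s _ (hg x))).1 rfl) }
  have hh : Function.Injective h := fun x y e =>
    Subtype.ext ((hP.fst_eq_iff _ (hg x) _ (hg y)).2 (congrArg Subtype.val e))
  have hgP : ∀ x y (hxy : (x, y) ∈ P), g ⟨x, y, hxy⟩ = y := fun x y hxy =>
    (hP.fst_eq_iff _ (hg ⟨x, y, hxy⟩) _ hxy).1 rfl
  obtain ⟨n, hnU, h1, h2, h3⟩ := hU M hM m D h hh (Prod.snd '' (P \ P₀))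
    (mk_image_le.trans_lt hcard)
  have hran : ∀ p ∈ P, p.2 ∈ base ∪ Prod.snd '' (P \ P₀) := by
    intro p hp
    by_cases hp0 : p ∈ P₀
    · exact Or.inl (hP₀ p hp0)
    · exact Or.inr ⟨p, ⟨hp, hp0⟩, rfl⟩
  -- On `D` the new pairs are old ones.
  have hold : ∀ s : S, s • m ∈ D → (s • m, s • n) ∈ P := by
    intro s hs
    rw [h1 s hs]
    exact hg ⟨s • m, hs⟩
  have hmix : ∀ p ∈ P, ∀ s : S, p.1 = s • m ↔ p.2 = s • n := by
    intro p hp s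
    by_cases hs : s • m ∈ D
    · exact hP.fst_eq_iff p hp _ (hold s hs)
    · refine iff_of_false (fun e => hs ⟨p.2, ?_⟩) (fun e => h2 s hs (e ▸ hran p hp))
      rw [← e]
      exact hp
  have hnew : ∀ s t : S, s • m = t • m ↔ s • n = t • n := by
    intro s t
    by_cases hs : s • m ∈ D
    · exact hmix _ (hold s hs) t
    · by_cases ht : t • m ∈ D
      · exact eq_comm.trans ((hmix _ (hold t ht) s).trans eq_comm)
      · exact (h3 s t hs ht).symm
  refine ⟨P ∪ Set.range fun s : S => (s • m, s • n), Set.subset_union_left, ⟨?_, ?_⟩, ?_, ?_,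
    n, Or.inr ⟨1, by simp⟩⟩
  · rintro s p (hp | ⟨t, rfl⟩)
    · exact Or.inl (hP.smul_mem s p hp)
    · exact Or.inr ⟨s * t, by simp [mul_smul]⟩
  · rintro p (hp | ⟨s, rfl⟩) q (hq | ⟨t, rfl⟩)
    · exact hP.fst_eq_iff p hp q hq
    · exact hmix p hp t
    · exact eq_comm.trans ((hmix q hq s).trans eq_comm)
    · exact hnew s t
  · rintro p (hp | ⟨s, rfl⟩)
    · exact hPU p hp
    · exact U.smul_mem s hnU
  · refine (mk_le_mk_of_subset ?_).trans
      (mk_range_le (f := fun s : S => ((s • m, s • n) : M × N)))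
    rintro p ⟨hp | hp, hpP⟩
    · exact absurd hp hpP
    · exact hp

end IsPartialIso

/-- Back-and-forth: rich acts of cardinality at most `lam` are isomorphic. -/
theorem Rich.exists_iso {M N : Type u} [MulAction S M] [MulAction S N] {lam : Cardinal.{u}}
    (hlam : ℵ₀ ≤ lam) (hS : #S < lam) (hM : #M ≤ lam) (hN : #N ≤ lam)
    (hRM : Rich lam ∅ (⊤ : SubMulAction S M)) (hRN : Rich lam ∅ (⊤ : SubMulAction S N)) :
    ∃ f : M →[S] N, Function.Bijective f := by
  obtain ⟨P, -, hP, htask⟩ := exists_subset_of_small_extensions (T := M × N) (K := M ⊕ N) hlam hS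
    (by
      rw [mk_sum, lift_id, lift_id]
      exact add_le_of_le hlam hM hN)
    (IsPartialIso S) ∅ ⟨fun _ _ h => h.elim, fun _ h => h.elim⟩ (fun c _ hc h => .sUnion hc h)
    (fun k P => Sum.elim (fun m => ∃ n, (m, n) ∈ P) (fun n => ∃ m, (m, n) ∈ P) k)
    (by
      rintro (m | n) P Q hPQ ⟨x, hx⟩
      · exact ⟨x, hPQ hx⟩
      · exact ⟨x, hPQ hx⟩)
    (by
      rintro P - hP hcard (m | n)
      · obtain ⟨Q, h1, h2, -, h3, h4⟩ := hP.exists_extension hRN hM (fun _ _ => trivial)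
          (P₀ := ∅) (fun _ h => h.elim) hcard m
        exact ⟨Q, h1, h2, h3, h4⟩
      · obtain ⟨Q, h1, h2, -, h3, x, hx⟩ := hP.swap.exists_extension hRM hN (fun _ _ => trivial)
          (P₀ := ∅) (fun _ h => h.elim)
          (by
            rw [Set.sdiff_empty] at hcard ⊢
            exact (mk_preimage_of_injective _ _ Prod.swap_injective).trans_lt hcard) n
        refine ⟨Prod.swap ⁻¹' Q, fun p hp => h1 (by simpa using hp), h2.swap, ?_, x, hx⟩
        refine le_trans ?_ h3
        refine (mk_le_mk_of_subset ?_).trans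
          (mk_preimage_of_injective Prod.swap (Q \ Prod.swap ⁻¹' P) Prod.swap_injective)
        rintro ⟨a, b⟩ ⟨h, h'⟩
        exact ⟨h, h'⟩)
  obtain ⟨f, hf, hfP⟩ := hP.exists_embedding fun m => htask (Sum.inl m)
  refine ⟨f, hf, fun n => ?_⟩
  obtain ⟨m, hm⟩ := htask (Sum.inr n)
  exact ⟨m, (hP.fst_eq_iff _ (hfP m) _ hm).1 rfl⟩

/-- Every extension of `A` of cardinality `lam` embeds into an act that is rich over `A`, by a
forth-construction that starts with the identity of `A`. -/
theorem Rich.extendsInto {lam : Cardinal.{u}} (hlam : ℵ₀ ≤ lam) (hS : #S < lam)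
    {A U : SubMulAction S W} (hA : #A = lam) (hAU : A ≤ U) (hU : Rich lam (A : Set W) U) :
    ExtendsInto A U := by
  intro N' _ hN' j hj
  have hN : #N' ≤ lam := (hN'.trans hA).le
  obtain ⟨P, hP₀, ⟨hP, hPU⟩, htask⟩ := exists_subset_of_small_extensions (T := N' × W) (K := N')
    hlam hS hN (fun P => IsPartialIso S P ∧ ∀ p ∈ P, p.2 ∈ U)
    (Set.range fun a : A => (j a, (a : W)))
    (by
      refine ⟨⟨?_, ?_⟩, ?_⟩
      · rintro s _ ⟨a, rfl⟩
        exact ⟨s • a, Prod.ext (map_smul j s a) rfl⟩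
      · rintro _ ⟨a, rfl⟩ _ ⟨b, rfl⟩
        exact hj.eq_iff.trans Subtype.ext_iff
      · rintro _ ⟨a, rfl⟩
        exact hAU a.2)
    (fun c _ hc h => ⟨.sUnion hc fun P hP => (h P hP).1, fun p ⟨P, hPc, hp⟩ => (h P hPc).2 p hp⟩)
    (fun x P => ∃ y, (x, y) ∈ P) (fun x P Q hPQ ⟨y, hy⟩ => ⟨y, hPQ hy⟩)
    (by
      rintro P - ⟨hP, hPU⟩ hcard x
      obtain ⟨Q, h1, h2, h3, h4, h5⟩ := hP.exists_extension hU hN hPU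
        (by
          rintro _ ⟨a, rfl⟩
          exact a.2) hcard x
      exact ⟨Q, h1, ⟨h2, h3⟩, h4, h5⟩)
  obtain ⟨f, hf, hfP⟩ := hP.exists_embedding htask
  refine ⟨⟨fun x => ⟨f x, hPU _ (hfP x)⟩, fun s x => Subtype.ext (map_smul f s x)⟩, ?_, ?_⟩
  · exact fun x y e => hf (congrArg Subtype.val e)
  · exact fun a => (hP.fst_eq_iff _ (hfP (j a)) _ (hP₀ ⟨a, rfl⟩)).1 rfl

/-! ### Uniqueness of limit models -/

theorem IsCardLimitModel.mk_le {lam : Cardinal.{u}} {M : Type u} [MulAction S M]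
    (h : IsCardLimitModel S lam M) : #M ≤ lam := by
  obtain ⟨α, N, -, hlam, -, hα', C, hcard, -, -, -, hunion, -⟩ := h
  have hsub : (Set.univ : Set M) ⊆
      ⋃ t : α.ToType, (C (Ordinal.ToType.mk.symm t).1 : Set M) := by
    rw [← hunion]
    refine Set.iUnion₂_subset fun i hi x hx => Set.mem_iUnion.2 ⟨Ordinal.ToType.mk ⟨i, hi⟩, ?_⟩
    simpa using hx
  rw [← mk_univ]
  refine (mk_le_mk_of_subset hsub).trans ((mk_iUnion_le _).trans ?_)
  refine mul_le_of_le hlam ?_ (ciSup_le' fun t => (hcard _ (Ordinal.ToType.mk.symm t).2).le)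
  rw [mk_toType]
  exact Order.lt_succ_iff.1 (lt_ord.1 hα')

/-- The chain of a limit model has length less than `lam⁺` but of any cofinality, possibly `ω`;
finite generation of ideals makes the limit model saturated regardless. -/
theorem IsCardLimitModel.rich (hS : WeaklyLeftNoetherian S) {lam : Cardinal.{u}} {M : Type u}
    [MulAction S M] (h : IsCardLimitModel S lam M) : Rich lam ∅ (⊤ : SubMulAction S M) := by
  obtain ⟨α, N, -, hlam, hα, hα', C, hcard, hmono, -, -, hunion, huniv⟩ := h
  have hα₀ : 0 < α := pos_iff_ne_zero.2 hα.ne_bot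
  have hR := rich_of_chain hS (mk_out lam) (fun i : Set.Iio α => C i.1)
    (fun i j hij => hmono i.1 j.1 hij j.2) (fun i => hcard i.1 i.2)
    (fun i => ⟨⟨Order.succ i.1, hα.succ_lt i.2⟩, by
      have hi := hcard i.1 i.2
      exact ExtendsInto.realizesFreely (hlam.trans hi.ge) (by rw [mk_out, hi])
        (huniv i.1 i.2).2.2⟩)
    ⊤ (by
      rw [Set.iUnion_subtype]
      exact hunion.symm)
    ⟨0, hα₀⟩
  intro M' _ hM' m D h hh X hX
  obtain ⟨n, h1, h2, h3, h4⟩ := hR M' hM' m D h hh X hX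
  exact ⟨n, h1, h2, fun s hs hmem => h3 s hs (Or.inr (hmem.resolve_left (Set.notMem_empty _))), h4⟩

/-! ### Existence of limit models -/

theorem mk_iSup_nat {lam : Cardinal.{u}} (hlam : ℵ₀ ≤ lam) (C : ℕ → SubMulAction S W)
    (hcard : ∀ n, #(C n) = lam) : #(⨆ n, C n : SubMulAction S W) = lam := by
  refine le_antisymm ?_ ?_
  · have hsub : ((⨆ n, C n : SubMulAction S W) : Set W) ⊆
        ⋃ n : ULift.{u} ℕ, (C n.down : Set W) := by
      intro x hx
      obtain ⟨n, hn⟩ := SubMulAction.mem_iSup.1 hx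
      exact Set.mem_iUnion.2 ⟨⟨n⟩, hn⟩
    refine (mk_le_mk_of_subset hsub).trans ((mk_iUnion_le _).trans ?_)
    refine mul_le_of_le hlam (by simpa using hlam) (ciSup_le' fun n => (hcard _).le)
  · rw [← hcard 0]
    exact mk_le_mk_of_subset (le_iSup C 0)

/-- A chain of length `ω` starting at `A`, each member of which is related to the next. -/
theorem exists_nat_chain {lam : Cardinal.{u}} (r : SubMulAction S W → SubMulAction S W → Prop)
    (hr : ∀ A : SubMulAction S W, #A = lam → ∃ B, A ≤ B ∧ #B = lam ∧ r A B)
    (A : SubMulAction S W) (hA : #A = lam) :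
    ∃ C : ℕ → SubMulAction S W, C 0 = A ∧ Monotone C ∧ (∀ n, #(C n) = lam) ∧
      ∀ n, r (C n) (C (n + 1)) := by
  choose next h1 h2 h3 using hr
  let C : ℕ → {B : SubMulAction S W // #B = lam} :=
    Nat.rec ⟨A, hA⟩ fun _ B => ⟨next B.1 B.2, h2 B.1 B.2⟩
  exact ⟨fun n => (C n).1, rfl, monotone_nat_of_le_succ fun n => h1 _ (C n).2, fun n => (C n).2,
    fun n => h3 _ (C n).2⟩

/-- All acts involved live in a cofree act, into which every extension of `A` of the same cardinality
embeds over `A`. Iterating `RealizesFreely.exists_small` countably often, starting at `A`, gives an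
act that is rich over `A`. -/
theorem WeaklyLeftNoetherian.exists_isUniversalOver (hS : WeaklyLeftNoetherian S)
    {lam : Cardinal.{u}} (hlam : 2 ^ (#S + ℵ₀) ≤ lam) {X : Type u} (hX : lam < #X)
    (A : SubMulAction S (Cofree S X)) (hA : #A = lam) : ∃ B, IsUniversalOver B A := by
  have hSlam : #S + ℵ₀ < lam := (cantor _).trans_le hlam
  have hlam₀ : ℵ₀ ≤ lam := (self_le_add_left _ _).trans hSlam.le
  have hS' : #S < lam := (self_le_add_right _ _).trans_lt hSlam
  have hK : #lam.out = lam := mk_out lam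
  obtain ⟨C, rfl, hmono, hcard, hfree⟩ := exists_nat_chain
    (fun A B : SubMulAction S (Cofree S X) => RealizesFreely A B lam.out)
    (fun A hA => by
      obtain ⟨B, h1, h2, h3⟩ := RealizesFreely.exists_small hS (by rwa [hA]) (by rw [hA, hK])
        ((Cofree.extendsInto_top A (by rwa [hA]) (by rwa [hA])).realizesFreely
          (K := lam.out) (by rwa [hA]) (by rw [hA, hK]))
      exact ⟨B, h1, h2.trans hA, h3⟩) A hA
  refine ⟨⨆ n, C n, le_iSup C 0, by rw [mk_iSup_nat hlam₀ C hcard, hA], ?_⟩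
  refine Rich.extendsInto hlam₀ hS' hA (le_iSup C 0) ?_
  refine rich_of_chain hS hK C hmono hcard (fun n => ⟨n + 1, hfree n⟩) _ ?_ 0
  ext x
  simp [SubMulAction.mem_iSup]

/-- `A ∩ V`, as a subact of `V`. -/
def restrict (V A : SubMulAction S W) : SubMulAction S V where
  carrier := {x | (x : W) ∈ A}
  smul_mem' s _ hx := A.smul_mem s hx

theorem mk_restrict {V A : SubMulAction S W} (h : A ≤ V) : #(restrict V A) = #A :=
  mk_congr
    { toFun := fun x => ⟨x.1.1, x.2⟩
      invFun := fun x => ⟨⟨x.1, h x.2⟩, x.2⟩ }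

theorem IsUniversalOver.restrict {V A B : SubMulAction S W} (hBV : B ≤ V)
    (h : IsUniversalOver B A) : IsUniversalOver (restrict V B) (restrict V A) := by
  obtain ⟨hAB, hcard, hext⟩ := h
  refine ⟨fun x hx => hAB hx, by rw [mk_restrict hBV, mk_restrict (hAB.trans hBV), hcard], ?_⟩
  intro N' _ hN' j hj
  let i : A →[S] SAct.restrict V A :=
    { toFun := fun x => ⟨⟨x.1, hBV (hAB x.2)⟩, x.2⟩
      map_smul' := fun _ _ => rfl }
  have hi : Function.Injective i := fun x y e => Subtype.ext (congrArg (fun z => z.1.1) e)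
  obtain ⟨f, hf, hfA⟩ := hext N' (hN'.trans (mk_restrict (hAB.trans hBV))) (j.comp i)
    (hj.comp hi)
  refine ⟨⟨fun x => ⟨⟨f x, hBV (f x).2⟩, (f x).2⟩, fun s x => ?_⟩, ?_, ?_⟩
  · exact Subtype.ext (Subtype.ext (congrArg (fun y : B => (y : W)) (map_smul f s x)))
  · exact fun x y e => hf (Subtype.ext (congrArg (fun z => z.1.1) e))
  · exact fun x => Subtype.ext (hfA ⟨x.1.1, x.2⟩)

theorem WeaklyLeftNoetherian.exists_isCardLimitModel (hS : WeaklyLeftNoetherian S)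
    {lam : Cardinal.{u}} (hlam : 2 ^ (#S + ℵ₀) ≤ lam) :
    ∃ (M : Type u) (_ : MulAction S M), IsCardLimitModel S lam M := by
  have hlam₀ : ℵ₀ ≤ lam := (self_le_add_left _ _).trans ((cantor _).le.trans hlam)
  obtain ⟨X, hX'⟩ : ∃ X : Type u, #X = Order.succ lam := ⟨_, mk_out _⟩
  have hX : lam < #X := hX' ▸ Order.lt_succ lam
  obtain ⟨A, hA⟩ := Cofree.exists_subMulAction_mk_eq (S := S) lam hX.le
  obtain ⟨C, -, hmono, hcard, huniv⟩ := exists_nat_chain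
    (fun A B : SubMulAction S (Cofree S X) => IsUniversalOver B A)
    (fun A hA => by
      obtain ⟨B, hB⟩ := hS.exists_isUniversalOver hlam hX A hA
      exact ⟨B, hB.1, hB.2.1.trans hA, hB⟩) A hA
  have hCV : ∀ n, C n ≤ ⨆ n, C n := le_iSup C
  -- The `n`-th member of the chain is indexed by the ordinal `n < ω`.
  have hnat : ∀ i < Ordinal.omega0.{u}, ∃ n : ℕ, i = n := fun i hi => Ordinal.lt_omega0.1 hi
  refine ⟨(⨆ n, C n : SubMulAction S (Cofree S X)), inferInstance, Ordinal.omega0,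
    restrict _ (C 0), (mk_restrict (hCV 0)).trans (hcard 0), hlam₀,
    Ordinal.isSuccLimit_omega0, ?_, fun i => restrict _ (C (toNat i.card)), ?_, ?_, ?_, ?_, ?_, ?_⟩
  · rw [lt_ord, Ordinal.card_omega0]
    exact hlam₀.trans_lt (Order.lt_succ lam)
  · exact fun i _ => (mk_restrict (hCV _)).trans (hcard _)
  · intro i j hij hj x hx
    obtain ⟨n, rfl⟩ := hnat j hj
    obtain ⟨m, rfl⟩ := hnat i (hij.trans_lt hj)
    refine hmono ?_ hx
    simpa using hij
  · intro i hi hlim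
    exact absurd (Ordinal.omega0_le_of_isSuccLimit hlim) hi.not_ge
  · simp
  · refine Set.eq_univ_of_forall fun x => ?_
    obtain ⟨n, hn⟩ := SubMulAction.mem_iSup.1 x.2
    refine Set.mem_iUnion₂.2 ⟨n, Ordinal.natCast_lt_omega0 n, ?_⟩
    change (x : Cofree S X) ∈ C _
    simpa using hn
  · intro i hi
    obtain ⟨n, rfl⟩ := hnat i hi
    have := (huniv n).restrict (hCV (n + 1))
    simpa using this

/-! ### Instability over other monoids -/

/-- No term of `f` is in the left ideal generated by the earlier terms. As that ideal is the union
of the left ideals generated by single terms, a condition on pairs of terms suffices. -/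
def IsIrredundant (f : ℕ → S) : Prop :=
  ∀ m n, m < n → ∀ t, t * f m ≠ f n

theorem exists_isIrredundant (h : ¬ WeaklyLeftNoetherian S) : ∃ f : ℕ → S, IsIrredundant f := by
  simp only [WeaklyLeftNoetherian, not_forall] at h
  obtain ⟨I, hI⟩ := h
  obtain ⟨f, -, hf⟩ := exists_seq_of_forall_finset_exists (· ∈ I) (fun x y => ∀ t, t * x ≠ y) (by
    intro G hG
    by_contra! hcon
    refine hI (SubMulAction.fg_iff.2 ⟨G, le_antisymm ?_ (SubMulAction.closure_le.2 hG)⟩)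
    intro y hy
    exact mem_closure_iff.2 (hcon y hy))
  exact ⟨f, hf⟩

/-- The left ideal generated by the range of `f`. -/
def rangeIdeal (f : ℕ → S) : SubMulAction S S where
  carrier := {x | ∃ k t, t * f k = x}
  smul_mem' := by
    rintro s _ ⟨k, t, rfl⟩
    exact ⟨k, s * t, mul_assoc s t _⟩

open Classical in
/-- The least `k` for which `x` is in the left ideal generated by `f k`. -/
noncomputable def level (f : ℕ → S) (x : rangeIdeal f) : ℕ :=
  Nat.find x.2

theorem level_smul_le (f : ℕ → S) (s : S) (x : rangeIdeal f) : level f (s • x) ≤ level f x := by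
  classical
  obtain ⟨t, ht⟩ : ∃ t, t * f (level f x) = x := Nat.find_spec x.2
  refine Nat.find_min' _ ⟨s * t, ?_⟩
  rw [mul_assoc, ht]
  rfl

theorem IsIrredundant.exists_level_eq {f : ℕ → S} (hf : IsIrredundant f) (k : ℕ) :
    ∃ x, level f x = k := by
  classical
  refine ⟨⟨f k, k, 1, one_mul _⟩, (Nat.find_eq_iff _).2 ⟨⟨1, one_mul _⟩, ?_⟩⟩
  rintro m hm ⟨t, ht⟩
  exact hf m k hm t ht

/-- Copies of the left ideal generated by `f`, one for each sequence in `Y`, where the copies of `x`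
for two sequences are identified if the sequences agree below the level of `x`. The copy of `x` is
encoded as `x` together with the list of the first `level f x` terms of the sequence. Shorter lists
are allowed as well: this saves proofs that a list has the right length, and does not affect the
cardinality. -/
def Tree (f : ℕ → S) (Y : Type u) : Type u :=
  {p : rangeIdeal f × List Y // p.2.length ≤ level f p.1}

namespace Tree

variable {f : ℕ → S} {Y : Type u}

noncomputable instance : MulAction S (Tree f Y) where
  smul s p := ⟨(s • p.1.1, p.1.2.take (level f (s • p.1.1))), List.length_take_le _ _⟩
  one_smul p := by
    refine Subtype.ext (Prod.ext (one_smul S p.1.1) ?_)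
    change p.1.2.take (level f ((1 : S) • p.1.1)) = p.1.2
    rw [one_smul]
    exact List.take_of_length_le p.2
  mul_smul s t p := by
    refine Subtype.ext (Prod.ext (mul_smul s t p.1.1) ?_)
    change p.1.2.take (level f ((s * t) • p.1.1)) =
      (p.1.2.take (level f (t • p.1.1))).take (level f (s • t • p.1.1))
    rw [mul_smul, List.take_take, min_eq_left (level_smul_le f s _)]

/-- The copy of the left ideal given by the sequence `η`. -/
noncomputable def branch (f : ℕ → S) (η : ℕ → Y) : rangeIdeal f →[S] Tree f Y where
  toFun x := ⟨(x, (List.range (level f x)).map η), by simp⟩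
  map_smul' s x := by
    refine Subtype.ext (Prod.ext rfl ?_)
    change (List.range (level f (s • x))).map η =
      ((List.range (level f x)).map η).take (level f (s • x))
    rw [← List.map_take, List.take_range, min_eq_left (level_smul_le f s x)]

theorem branch_injective (hf : IsIrredundant f) :
    Function.Injective (branch f : (ℕ → Y) → rangeIdeal f →[S] Tree f Y) := by
  intro η η' h
  funext k
  obtain ⟨x, hx⟩ := hf.exists_level_eq (k + 1)
  have h' : (List.range (level f x)).map η = (List.range (level f x)).map η' :=
    congrArg (fun g : rangeIdeal f →[S] Tree f Y => (g x).1.2) h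
  exact List.map_inj_left.1 h' k (by simp [hx])

theorem mk_le {lam : Cardinal.{u}} (hlam : ℵ₀ ≤ lam) (hS : #S ≤ lam) (hY : #Y = lam) :
    #(Tree f Y) ≤ lam := by
  have : Infinite Y := infinite_iff.2 (hlam.trans hY.ge)
  refine (mk_subtype_le _).trans ?_
  rw [mk_prod, lift_id, lift_id, mk_list_eq_mk, hY]
  exact mul_le_of_le hlam ((mk_subtype_le _).trans hS) le_rfl

end Tree

/-- If `C₀`, `C₁`, `C₂` are consecutive members of the chain of a limit model, then the tree act
embeds into `C₁`, and the extensions of `C₁` by the pushouts along its `lam ^ ℵ₀` branches are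
realized by different elements of `C₂`. -/
theorem IsIrredundant.power_aleph0_le {f : ℕ → S} (hf : IsIrredundant f) {lam : Cardinal.{u}}
    (hS : #S ≤ lam) {M : Type u} [MulAction S M] (hM : IsCardLimitModel S lam M) :
    lam ^ ℵ₀ ≤ lam := by
  obtain ⟨α, N, -, hlam, hα, -, C, hcard, -, -, -, -, huniv⟩ := hM
  have hα₀ : 0 < α := pos_iff_ne_zero.2 hα.ne_bot
  have hα₁ := hα.succ_lt hα₀
  have hα₂ := hα.succ_lt hα₁
  have hY : #lam.out = lam := mk_out lam
  have : Nonempty lam.out := mk_ne_zero_iff.1 (by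
    rw [hY]
    exact (aleph0_pos.trans_le hlam).ne')
  obtain ⟨e, he, -⟩ := (huniv 0 hα₀).2.2 (C 0 ⊕ Tree f lam.out)
    (by
      rw [mk_sum, lift_id, lift_id, hcard 0 hα₀]
      exact add_eq_left hlam (Tree.mk_le hlam hS hY))
    ⟨Sum.inl, fun _ _ => rfl⟩ Sum.inl_injective
  have hcard₁ := hcard _ hα₁
  have hreal : RealizesFreely (C (Order.succ 0)) (C (Order.succ (Order.succ 0))) lam.out :=
    ExtendsInto.realizesFreely (hlam.trans hcard₁.ge) (by rw [hY, hcard₁]) (huniv _ hα₁).2.2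
  let h : (ℕ → lam.out) → rangeIdeal f →[S] C (Order.succ 0) := fun η =>
    { toFun := fun x => e (Sum.inr (Tree.branch f η x))
      map_smul' := fun s x => by
        rw [map_smul]
        exact map_smul e s (Sum.inr (Tree.branch f η x)) }
  choose c hcmem hc using fun η => hreal S (hS.trans hcard₁.ge) 1 (rangeIdeal f) (h η)
  let k : lam.out := Classical.arbitrary _
  have hinj : Function.Injective
      fun η => (⟨c η k, hcmem η k⟩ : C (Order.succ (Order.succ 0))) := by
    intro η η' hηη'
    have heq : c η k = c η' k := congrArg Subtype.val hηη'
    refine Tree.branch_injective hf (DFunLike.ext _ _ fun x => ?_)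
    have hx : (x : S) • (1 : S) ∈ rangeIdeal f := by simp
    have hx' : (⟨(x : S) • (1 : S), hx⟩ : rangeIdeal f) = x := Subtype.ext (mul_one _)
    have h1 := (hc η).smul_of_mem k x hx
    have h2 := (hc η').smul_of_mem k x hx
    rw [hx'] at h1 h2
    rw [heq, h2] at h1
    exact Sum.inr_injective (he (Subtype.ext h1.symm))
  have := mk_le_of_injective hinj
  rw [hcard _ hα₂] at this
  simpa [hY] using this

theorem exists_lt_power_aleph0 (μ : Cardinal.{u}) : ∃ lam, μ ≤ lam ∧ lam < lam ^ ℵ₀ := by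
  have hlim : Order.IsSuccLimit (μ.ord + Ordinal.omega0) :=
    Ordinal.isSuccLimit_add _ Ordinal.isSuccLimit_omega0
  refine ⟨ℵ_ (μ.ord + Ordinal.omega0), ?_, ?_⟩
  · rw [← ord_le_ord, ord_aleph]
    exact le_self_add.trans (Ordinal.omega_strictMono.le_apply)
  · have := lt_power_cof_ord (aleph0_le_aleph (μ.ord + Ordinal.omega0))
    rwa [ord_aleph, Ordinal.cof_omega hlim, Ordinal.cof_add _ Ordinal.omega0_ne_zero,
      Ordinal.cof_omega0] at this

theorem LS_le : LS S ≤ #S + ℵ₀ := by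
  refine csInf_le' ⟨le_rfl, fun A _ X => ⟨SubMulAction.closure S X,
    SubMulAction.subset_closure, ?_⟩⟩
  have hsub : ((SubMulAction.closure S X : SubMulAction S A) : Set A) ⊆
      Set.range fun p : X × S => p.2 • (p.1 : A) := by
    intro x hx
    obtain ⟨g, hg, s, rfl⟩ := mem_closure_iff.1 hx
    exact ⟨(⟨g, hg⟩, s), rfl⟩
  refine (mk_le_mk_of_subset hsub).trans (mk_range_le.trans ?_)
  rw [mk_prod, lift_id, lift_id]
  have h : ℵ₀ ≤ #X + (#S + ℵ₀) := (self_le_add_left _ _).trans (self_le_add_left _ _)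
  exact mul_le_of_le h (self_le_add_right _ _)
    ((self_le_add_right _ _).trans (self_le_add_left _ _))

end SAct

theorem theorem4 (S : Type u) [Monoid S] :
    SAct.WeaklyLeftNoetherian S ↔ SAct.Superstable S := by
  constructor
  · intro hS
    refine ⟨2 ^ (#S + ℵ₀), SAct.LS_le.trans (cantor _).le, fun lam hlam =>
      ⟨hS.exists_isCardLimitModel hlam, fun M N _ _ hM hN => ?_⟩⟩
    have hκ : #S + ℵ₀ < lam := (cantor _).trans_le hlam
    exact SAct.Rich.exists_iso ((self_le_add_left _ _).trans hκ.le)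
      ((self_le_add_right _ _).trans_lt hκ) hM.mk_le hN.mk_le (hM.rich hS) (hN.rich hS)
  · rintro ⟨μ, -, hμ⟩
    by_contra hS
    obtain ⟨f, hf⟩ := SAct.exists_isIrredundant hS
    obtain ⟨lam, hlam, hlt⟩ := SAct.exists_lt_power_aleph0 (max μ #S)
    obtain ⟨M, _, hM⟩ := (hμ lam ((le_max_left _ _).trans hlam)).1
    exact hlt.not_ge (hf.power_aleph0_le ((le_max_right _ _).trans hlam) hM)
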